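/- Let $\Phi$ be a (reduced, crystallographic, finite) root system spanning a real vector space $V$, let $\Delta\subset\Phi$ be a base, and let $W$ be the Weyl group of $\Phi$, acting on $V$. Let $\ell$ be the length function on $W$ with respect to the simple reflections $s_\alpha$ ($\alpha\in\Delta$), and let $\leq$ be the Bruhat order on $W$, i.e. the reflexive and transitive closure of the relations $u<us_\beta$ for $u\in W$ and $\beta\in\Phi$ with $\ell(u)<\ell(us_\beta)$. For $u\in W$ let $\mathrm{rk}(1-u)$ be the rank of the linear map $1-u$ on $V$. Let $w,\sigma\in W$ satisfy $w^2=\sigma^2=1$ (the identity is allowed), $w\leq\sigma$ and $$\ell(w)+\mathrm{rk}(1-w)=\ell(\sigma)+\mathrm{rk}(1-\sigma).$$ Then $w=\sigma$. -/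

import Mathlib

noncomputable section

namespace WeylInvolutions

open RootPairing

variable {ι V N : Type*} [AddCommGroup V] [Module ℝ V] [AddCommGroup N] [Module ℝ N]

/-- The product in the Weyl group of a word in the simple reflections attached to the base `b`. -/
def wordProd {P : RootPairing ι ℝ V N} (b : P.Base) (ω : List b.support) : P.weylGroup :=
  (ω.map fun i : b.support => weylGroup.ofIdx P (i : ι)).prod

/-- The simple reflections generate the Weyl group, so `length` is a minimum over a non-empty set. -/
theorem exists_wordProd_eq [Finite ι] {P : RootPairing ι ℝ V N} [P.IsCrystallographic]
    [P.IsReduced] (b : P.Base) (w : P.weylGroup) : ∃ ω : List b.support, wordProd b ω = w := by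
  let S : Submonoid P.weylGroup :=
    { carrier := {u | ∃ ω : List b.support, wordProd b ω = u}
      one_mem' := ⟨[], rfl⟩
      mul_mem' := by
        rintro _ _ ⟨ω, rfl⟩ ⟨ω', rfl⟩
        exact ⟨ω ++ ω', by simp [wordProd]⟩ }
  have hinj : ∀ u v : P.weylGroup, (∀ x : V, u • x = v • x) → u = v := by
    intro u v h
    apply Subtype.ext
    apply Equiv.weightHom_injective P
    ext x
    exact h x
  have hrefl : ∀ i : ι, weylGroup.ofIdx P i ∈ S := by
    intro i
    refine b.induction_reflect i (p := fun i => weylGroup.ofIdx P i ∈ S) ?_ ?_ ?_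
    · intro i hi
      have : weylGroup.ofIdx P (P.reflectionPerm i i) = weylGroup.ofIdx P i := by
        apply hinj
        intro x
        simp [reflection_reflectionPerm]
      rwa [this]
    · intro i hi
      exact ⟨[⟨i, hi⟩], by simp [wordProd]⟩
    · intro i j hi hj
      have hj' : weylGroup.ofIdx P j ∈ S := ⟨[⟨j, hj⟩], by simp [wordProd]⟩
      have : weylGroup.ofIdx P (P.reflectionPerm j i) =
          weylGroup.ofIdx P j * weylGroup.ofIdx P i * weylGroup.ofIdx P j := by
        apply hinj
        intro x
        simp [reflection_reflectionPerm, mul_smul]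
      rw [this]
      exact S.mul_mem (S.mul_mem hj' hi) hj'
  obtain ⟨g, hg⟩ := w
  change (⟨g, hg⟩ : P.weylGroup) ∈ S
  induction hg using weylGroup.induction with
  | mem i => exact hrefl i
  | one => exact S.one_mem
  | mul x y hx hy hx' hy' => exact S.mul_mem hx' hy'

/-- The length function of the Weyl group with respect to the base `b`: the least length of a word
in the simple reflections whose product is `w`. -/
def length {P : RootPairing ι ℝ V N} (b : P.Base) (w : P.weylGroup) : ℕ :=
  sInf {n : ℕ | ∃ ω : List b.support, ω.length = n ∧ wordProd b ω = w}

/-- An elementary step up in the Bruhat order: `v = u * t` where `t` is the reflection in some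
(not necessarily simple) root and `ℓ(u) < ℓ(v)`. -/
def BruhatStep {P : RootPairing ι ℝ V N} (b : P.Base) (u v : P.weylGroup) : Prop :=
  ∃ i : ι, v = u * weylGroup.ofIdx P i ∧ length b u < length b v

/-- The Bruhat order on the Weyl group: the reflexive transitive closure of the elementary
steps. -/
def BruhatLE {P : RootPairing ι ℝ V N} (b : P.Base) (u v : P.weylGroup) : Prop :=
  Relation.ReflTransGen (BruhatStep b) u v

/-- The rank of `1 - w` in the reflection representation of the Weyl group on the real vector
space `V` that contains the roots. -/
def rkOneSub (P : RootPairing ι ℝ V N) (w : P.weylGroup) : ℕ :=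
  Module.finrank ℝ (LinearMap.range (1 - P.weylGroupRootRep w))

end WeylInvolutions

end

noncomputable section

namespace WeylInvolutions

open RootPairing

/-! ### Roots and reflections under the Weyl group action, and words in simple reflections. -/

section Basic

variable {ι V N : Type*} [AddCommGroup V] [Module ℝ V] [AddCommGroup N] [Module ℝ N]
  {P : RootPairing ι ℝ V N}

/-! On involutions, `f = length + rkOneSub` is strictly increasing for the Bruhat order
(`BruhatLE.length_add_rkOneSub`). Induct on the length of `σ`, with `s` a simple right descent of
`σ`. The twisted action sends `σ` to `σs` if the two commute and to `sσs` otherwise, and lowers `f`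
by exactly 2: in the first case `σ` negates the root of `s`, so length and rank each drop by one; in
the second the length drops by two and conjugation preserves the rank. By the lifting property, if
`s` is also a descent of `w` then both can be twisted and stay comparable; otherwise `w` lies below
the twist of `σ`. Induction finishes either case, since twisting is injective. -/

theorem weylGroup_ext {u v : P.weylGroup} (h : ∀ x : V, u • x = v • x) : u = v := by
  apply Subtype.ext
  apply Equiv.weightHom_injective P
  ext x
  exact h x

@[simp]
theorem weylGroupToPerm_ofIdx (i j : ι) :
    P.weylGroupToPerm (weylGroup.ofIdx P i) j = P.reflectionPerm i j := by
  apply P.root.injective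
  rw [← P.weylGroup_apply_root]
  simp

theorem ofIdx_mul_self (i : ι) : weylGroup.ofIdx P i * weylGroup.ofIdx P i = 1 := by
  apply weylGroup_ext
  intro x
  simp [mul_smul]

theorem ofIdx_inv (i : ι) : (weylGroup.ofIdx P i)⁻¹ = weylGroup.ofIdx P i :=
  inv_eq_of_mul_eq_one_left (ofIdx_mul_self i)

theorem mul_ofIdx_cancel (u : P.weylGroup) (i : ι) :
    u * weylGroup.ofIdx P i * weylGroup.ofIdx P i = u := by
  rw [mul_assoc, ofIdx_mul_self, mul_one]

theorem ofIdx_mul_cancel (u : P.weylGroup) (i : ι) :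
    weylGroup.ofIdx P i * (weylGroup.ofIdx P i * u) = u := by
  rw [← mul_assoc, ofIdx_mul_self, one_mul]

theorem ofIdx_reflectionPerm (i j : ι) : weylGroup.ofIdx P (P.reflectionPerm j i) =
    weylGroup.ofIdx P j * weylGroup.ofIdx P i * weylGroup.ofIdx P j := by
  apply weylGroup_ext
  intro x
  simp [reflection_reflectionPerm, mul_smul]

theorem ofIdx_reflectionPerm_self (i : ι) :
    weylGroup.ofIdx P (P.reflectionPerm i i) = weylGroup.ofIdx P i := by
  rw [ofIdx_reflectionPerm, mul_ofIdx_cancel]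

/-- Conjugating a reflection by `g` gives the reflection in the image of its root under `g`. -/
theorem mul_ofIdx (g : P.weylGroup) (i : ι) :
    g * weylGroup.ofIdx P i = weylGroup.ofIdx P (P.weylGroupToPerm g i) * g := by
  obtain ⟨g, hg⟩ := g
  induction hg using weylGroup.induction generalizing i with
  | mem j =>
    change weylGroup.ofIdx P j * weylGroup.ofIdx P i =
      weylGroup.ofIdx P (P.weylGroupToPerm (weylGroup.ofIdx P j) i) * weylGroup.ofIdx P j
    rw [weylGroupToPerm_ofIdx, ofIdx_reflectionPerm, mul_ofIdx_cancel]
  | one =>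
    change 1 * _ = weylGroup.ofIdx P (P.weylGroupToPerm 1 i) * 1
    simp
  | mul x y hx hy ihx ihy =>
    have h : (⟨x * y, mul_mem hx hy⟩ : P.weylGroup) = ⟨x, hx⟩ * ⟨y, hy⟩ := rfl
    rw [h, mul_assoc, ihy, ← mul_assoc, ihx, mul_assoc, map_mul]
    rfl

theorem weylGroupToPerm_reflectionPerm_self (g : P.weylGroup) (i : ι) :
    P.weylGroupToPerm g (P.reflectionPerm i i) =
      P.reflectionPerm (P.weylGroupToPerm g i) (P.weylGroupToPerm g i) := by
  apply P.root.injective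
  rw [← P.weylGroup_apply_root]
  simp only [root_reflectionPerm, reflection_apply_self, smul_neg, P.weylGroup_apply_root]

theorem isPos_reflectionPerm_self (b : P.Base) (i : ι) :
    b.IsPos (P.reflectionPerm i i) ↔ ¬ b.IsPos i :=
  Base.IsPos.neg_iff_not b i

theorem isPos_of_mem (b : P.Base) {i : ι} (hi : i ∈ b.support) : b.IsPos i :=
  Base.isPos_of_mem_support hi

theorem wordProd_cons (b : P.Base) (i : b.support) (ω : List b.support) :
    wordProd b (i :: ω) = weylGroup.ofIdx P i * wordProd b ω := by
  simp [wordProd]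

theorem wordProd_append (b : P.Base) (ω ω' : List b.support) :
    wordProd b (ω ++ ω') = wordProd b ω * wordProd b ω' := by
  simp [wordProd]

theorem wordProd_singleton (b : P.Base) (i : b.support) :
    wordProd b [i] = weylGroup.ofIdx P i := by
  simp [wordProd]

theorem wordProd_reverse (b : P.Base) (ω : List b.support) :
    wordProd b ω.reverse = (wordProd b ω)⁻¹ := by
  induction ω with
  | nil => simp [wordProd]
  | cons i ω ih =>
    rw [List.reverse_cons, wordProd_append, ih, wordProd_singleton, wordProd_cons, mul_inv_rev,
      ofIdx_inv]

theorem length_wordProd_le (b : P.Base) (ω : List b.support) :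
    length b (wordProd b ω) ≤ ω.length :=
  Nat.sInf_le ⟨ω, rfl, rfl⟩

theorem isPos_mul_ofIdx_iff (b : P.Base) (w : P.weylGroup) (i : ι) :
    b.IsPos (P.weylGroupToPerm (w * weylGroup.ofIdx P i) i) ↔
      ¬ b.IsPos (P.weylGroupToPerm w i) := by
  rw [map_mul, Equiv.Perm.mul_apply, weylGroupToPerm_ofIdx, weylGroupToPerm_reflectionPerm_self,
    isPos_reflectionPerm_self]

theorem inv_inv_mul_ofIdx (u : P.weylGroup) (i : ι) :
    (u⁻¹ * weylGroup.ofIdx P i)⁻¹ = weylGroup.ofIdx P i * u := by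
  rw [mul_inv_rev, inv_inv, ofIdx_inv]

/-- The smaller of `u` and `u * s`, where `s` is the reflection with index `i`. -/
def rightDown (b : P.Base) (u : P.weylGroup) (i : ι) : P.weylGroup :=
  open Classical in
  if b.IsPos (P.weylGroupToPerm u i) then u else u * weylGroup.ofIdx P i

theorem rightDown_of_isPos {b : P.Base} {u : P.weylGroup} {i : ι} (h : b.IsPos (P.weylGroupToPerm u i)) :
    rightDown b u i = u := if_pos h

theorem rightDown_of_not_isPos {b : P.Base} {u : P.weylGroup} {i : ι}
    (h : ¬ b.IsPos (P.weylGroupToPerm u i)) :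
    rightDown b u i = u * weylGroup.ofIdx P i := if_neg h

theorem rightDown_mul_ofIdx (b : P.Base) (u : P.weylGroup) (i : ι) :
    rightDown b (u * weylGroup.ofIdx P i) i = rightDown b u i := by
  by_cases h : b.IsPos (P.weylGroupToPerm u i)
  · rw [rightDown_of_isPos h, rightDown_of_not_isPos (by rwa [isPos_mul_ofIdx_iff, not_not]),
      mul_ofIdx_cancel]
  · rw [rightDown_of_not_isPos h, rightDown_of_isPos (by rwa [isPos_mul_ofIdx_iff])]

end Basic

/-! ### Length, strong exchange and descents. -/

section Length

variable {ι V N : Type*} [Finite ι] [AddCommGroup V] [Module ℝ V] [AddCommGroup N] [Module ℝ N]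
  {P : RootPairing ι ℝ V N} [P.IsCrystallographic] [P.IsReduced] (b : P.Base)

theorem exists_reduced_word (w : P.weylGroup) :
    ∃ ω : List b.support, ω.length = length b w ∧ wordProd b ω = w := by
  obtain ⟨ω, hω⟩ := exists_wordProd_eq b w
  exact Nat.sInf_mem (s := {n : ℕ | ∃ ω : List b.support, ω.length = n ∧ wordProd b ω = w})
    ⟨_, ω, rfl, hω⟩

theorem length_inv_le (w : P.weylGroup) : length b w⁻¹ ≤ length b w := by
  obtain ⟨ω, hl, rfl⟩ := exists_reduced_word b w
  rw [← wordProd_reverse, ← hl, ← List.length_reverse]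
  exact length_wordProd_le b _

theorem length_inv (w : P.weylGroup) : length b w⁻¹ = length b w :=
  le_antisymm (length_inv_le b w) (by simpa using length_inv_le b w⁻¹)

theorem length_mul_simple_le (w : P.weylGroup) {i : ι} (hi : i ∈ b.support) :
    length b (w * weylGroup.ofIdx P i) ≤ length b w + 1 := by
  obtain ⟨ω, hl, rfl⟩ := exists_reduced_word b w
  have := length_wordProd_le b (ω ++ [⟨i, hi⟩])
  rw [wordProd_append, wordProd_singleton] at this
  simpa [hl] using this

/-- The strong exchange property. -/
theorem exists_word_mul_reflection (ω : List b.support) {i : ι} (hi : b.IsPos i)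
    (hω : ¬ b.IsPos (P.weylGroupToPerm (wordProd b ω) i)) :
    ∃ ω' : List b.support, ω'.length + 1 = ω.length ∧
      wordProd b ω' = wordProd b ω * weylGroup.ofIdx P i := by
  induction ω with
  | nil => exact absurd hi (by simpa [wordProd] using hω)
  | cons j ω ih =>
    by_cases h : b.IsPos (P.weylGroupToPerm (wordProd b ω) i)
    · refine ⟨ω, rfl, ?_⟩
      rw [wordProd_cons, map_mul, Equiv.Perm.mul_apply, weylGroupToPerm_ofIdx] at hω
      -- A simple reflection makes only its own root negative among the positive roots, so the sign
      -- changes at the letter `j` only if the root there is `j`; that letter is then deleted.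
      have hj : P.weylGroupToPerm (wordProd b ω) i = j := by
        by_contra hne
        exact hω (h.reflectionPerm j.2 hne)
      rw [wordProd_cons, mul_assoc, mul_ofIdx, hj, ofIdx_mul_cancel]
    · obtain ⟨ω', hl, hp⟩ := ih h
      refine ⟨j :: ω', by simpa using hl, ?_⟩
      rw [wordProd_cons, wordProd_cons, hp, mul_assoc]

theorem length_mul_ofIdx_lt (w : P.weylGroup) {i : ι} (hi : b.IsPos i)
    (hw : ¬ b.IsPos (P.weylGroupToPerm w i)) :
    length b (w * weylGroup.ofIdx P i) < length b w := by
  obtain ⟨ω, hl, rfl⟩ := exists_reduced_word b w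
  obtain ⟨ω', hl', hp⟩ := exists_word_mul_reflection b ω hi hw
  have := length_wordProd_le b ω'
  rw [← hp]
  lia

theorem length_lt_mul_ofIdx (w : P.weylGroup) {i : ι} (hi : b.IsPos i)
    (hw : b.IsPos (P.weylGroupToPerm w i)) :
    length b w < length b (w * weylGroup.ofIdx P i) := by
  have := length_mul_ofIdx_lt b (w * weylGroup.ofIdx P i) hi
    (by rwa [isPos_mul_ofIdx_iff, not_not])
  rwa [mul_ofIdx_cancel] at this

theorem length_eq_mul_simple_add_one (w : P.weylGroup) {i : ι} (hi : i ∈ b.support)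
    (hw : ¬ b.IsPos (P.weylGroupToPerm w i)) :
    length b w = length b (w * weylGroup.ofIdx P i) + 1 := by
  have h₁ := length_mul_ofIdx_lt b w (isPos_of_mem b hi) hw
  have h₂ := length_mul_simple_le b (w * weylGroup.ofIdx P i) hi
  rw [mul_ofIdx_cancel] at h₂
  lia

theorem exists_descent {w : P.weylGroup} (hw : w ≠ 1) :
    ∃ i ∈ b.support, ¬ b.IsPos (P.weylGroupToPerm w i) := by
  obtain ⟨ω, hl, hp⟩ := exists_reduced_word b w
  rcases List.eq_nil_or_concat ω with rfl | ⟨ω', i, rfl⟩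
  · exact absurd (by simpa [wordProd] using hp.symm) hw
  · refine ⟨i, i.2, fun hpos => ?_⟩
    have h₁ := length_lt_mul_ofIdx b w (isPos_of_mem b i.2) hpos
    have h₂ := length_wordProd_le b ω'
    rw [List.concat_eq_append] at hp hl
    rw [wordProd_append, wordProd_singleton] at hp
    rw [← hp, mul_ofIdx_cancel, hp] at h₁
    simp at hl
    lia

end Length

/-! ### The Bruhat order and its lifting properties. -/

section Bruhat

variable {ι V N : Type*} [Finite ι] [AddCommGroup V] [Module ℝ V] [AddCommGroup N] [Module ℝ N]
  {P : RootPairing ι ℝ V N} [P.IsCrystallographic] [P.IsReduced] {b : P.Base}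

/-- A root and its negative give the same reflection, so the root may be taken positive; strong
exchange then turns the length inequality into a sign condition. -/
theorem BruhatStep.exists_isPos {u v : P.weylGroup} (h : BruhatStep b u v) :
    ∃ i, b.IsPos i ∧ b.IsPos (P.weylGroupToPerm u i) ∧ v = u * weylGroup.ofIdx P i := by
  obtain ⟨i, rfl, hl⟩ := h
  have key : ∀ j, b.IsPos j → weylGroup.ofIdx P j = weylGroup.ofIdx P i →
      ∃ i', b.IsPos i' ∧ b.IsPos (P.weylGroupToPerm u i') ∧
        u * weylGroup.ofIdx P i = u * weylGroup.ofIdx P i' := by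
    intro j hj hji
    refine ⟨j, hj, ?_, by rw [hji]⟩
    by_contra hneg
    have := length_mul_ofIdx_lt b u hj hneg
    rw [hji] at this
    lia
  by_cases hi : b.IsPos i
  · exact key i hi rfl
  · exact key _ ((isPos_reflectionPerm_self b i).2 hi) (ofIdx_reflectionPerm_self i)

theorem bruhatStep_mul_ofIdx (u : P.weylGroup) {i : ι} (hi : b.IsPos i)
    (hu : b.IsPos (P.weylGroupToPerm u i)) : BruhatStep b u (u * weylGroup.ofIdx P i) :=
  ⟨i, rfl, length_lt_mul_ofIdx b u hi hu⟩

theorem bruhatStep_of_descent {u : P.weylGroup} {i : ι} (hi : i ∈ b.support)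
    (hu : ¬ b.IsPos (P.weylGroupToPerm u i)) : BruhatStep b (u * weylGroup.ofIdx P i) u :=
  ⟨i, (mul_ofIdx_cancel u i).symm, length_mul_ofIdx_lt b u (isPos_of_mem b hi) hu⟩

theorem BruhatStep.mul_simple {u v : P.weylGroup} (h : BruhatStep b u v) {i : ι}
    (hi : i ∈ b.support) :
    v = u * weylGroup.ofIdx P i ∨
      BruhatStep b (u * weylGroup.ofIdx P i) (v * weylGroup.ofIdx P i) := by
  obtain ⟨j, hj, huj, rfl⟩ := h.exists_isPos
  by_cases hji : j = i
  · exact Or.inl (by rw [hji])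
  · right
    have h := bruhatStep_mul_ofIdx (b := b) (u * weylGroup.ofIdx P i)
      (hj.reflectionPerm hi hji) (by
        rwa [map_mul, Equiv.Perm.mul_apply, weylGroupToPerm_ofIdx, reflectionPerm_self])
    rw [ofIdx_reflectionPerm] at h
    simpa only [← mul_assoc, mul_ofIdx_cancel] using h

theorem rightDown_le (u : P.weylGroup) {i : ι} (hi : i ∈ b.support) :
    BruhatLE b (rightDown b u i) u := by
  by_cases h : b.IsPos (P.weylGroupToPerm u i)
  · rw [rightDown_of_isPos h]
    exact .refl
  · rw [rightDown_of_not_isPos h]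
    exact .single (bruhatStep_of_descent hi h)

/-- Monotonicity of this projection contains both lifting properties below. It suffices to check one
step `u → v`: either `v = us` and the projections agree, or `us → vs` is also a step. -/
theorem BruhatLE.rightDown {u v : P.weylGroup} (h : BruhatLE b u v) {i : ι}
    (hi : i ∈ b.support) : BruhatLE b (rightDown b u i) (rightDown b v i) := by
  refine Relation.ReflTransGen.trans_induction_on (motive := fun {u v} _ =>
    BruhatLE b (WeylInvolutions.rightDown b u i) (WeylInvolutions.rightDown b v i)) h
    (fun _ => .refl) ?_ (fun _ _ h₁ h₂ => h₁.trans h₂)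
  intro u v h
  rcases h.mul_simple hi with rfl | h'
  · rw [rightDown_mul_ofIdx b]
    exact .refl
  · by_cases hv : b.IsPos (P.weylGroupToPerm v i)
    · rw [rightDown_of_isPos hv]
      exact (rightDown_le u hi).tail h
    · rw [rightDown_of_not_isPos hv, ← rightDown_mul_ofIdx b u]
      exact (rightDown_le _ hi).tail h'

/-- The lifting property: a common right descent can be removed from both sides. -/
theorem BruhatLE.mul_mul {u v : P.weylGroup} (h : BruhatLE b u v) {i : ι} (hi : i ∈ b.support)
    (hu : ¬ b.IsPos (P.weylGroupToPerm u i)) (hv : ¬ b.IsPos (P.weylGroupToPerm v i)) :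
    BruhatLE b (u * weylGroup.ofIdx P i) (v * weylGroup.ofIdx P i) := by
  simpa only [rightDown_of_not_isPos hu, rightDown_of_not_isPos hv] using h.rightDown hi

/-- The lifting property: a right descent of the larger element only can be removed from it. -/
theorem BruhatLE.le_mul {u v : P.weylGroup} (h : BruhatLE b u v) {i : ι} (hi : i ∈ b.support)
    (hu : b.IsPos (P.weylGroupToPerm u i)) (hv : ¬ b.IsPos (P.weylGroupToPerm v i)) :
    BruhatLE b u (v * weylGroup.ofIdx P i) := by
  simpa only [rightDown_of_isPos hu, rightDown_of_not_isPos hv] using h.rightDown hi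

theorem BruhatLE.inv {u v : P.weylGroup} (h : BruhatLE b u v) : BruhatLE b u⁻¹ v⁻¹ := by
  refine Relation.ReflTransGen.lift (fun u : P.weylGroup => u⁻¹) ?_ _ _ h
  rintro u _ ⟨i, rfl, hl⟩
  refine ⟨P.weylGroupToPerm u i, ?_, by rwa [length_inv, length_inv]⟩
  change (u * weylGroup.ofIdx P i)⁻¹ = u⁻¹ * _
  rw [mul_ofIdx, mul_inv_rev, ofIdx_inv]

theorem BruhatLE.left_mul_mul {u v : P.weylGroup} (h : BruhatLE b u v) {i : ι}
    (hi : i ∈ b.support) (hu : ¬ b.IsPos (P.weylGroupToPerm u⁻¹ i))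
    (hv : ¬ b.IsPos (P.weylGroupToPerm v⁻¹ i)) :
    BruhatLE b (weylGroup.ofIdx P i * u) (weylGroup.ofIdx P i * v) := by
  simpa only [inv_inv_mul_ofIdx] using (h.inv.mul_mul hi hu hv).inv

theorem BruhatLE.left_le_mul {u v : P.weylGroup} (h : BruhatLE b u v) {i : ι}
    (hi : i ∈ b.support) (hu : b.IsPos (P.weylGroupToPerm u⁻¹ i))
    (hv : ¬ b.IsPos (P.weylGroupToPerm v⁻¹ i)) :
    BruhatLE b u (weylGroup.ofIdx P i * v) := by
  simpa only [inv_inv_mul_ofIdx, inv_inv] using (h.inv.le_mul hi hu hv).inv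

theorem left_mul_le_of_descent {u : P.weylGroup} {i : ι} (hi : i ∈ b.support)
    (hu : ¬ b.IsPos (P.weylGroupToPerm u⁻¹ i)) : BruhatLE b (weylGroup.ofIdx P i * u) u := by
  have h : BruhatLE b (u⁻¹ * weylGroup.ofIdx P i) u⁻¹ := .single (bruhatStep_of_descent hi hu)
  simpa only [inv_inv_mul_ofIdx, inv_inv] using h.inv

end Bruhat

/-! ### The twisted action on involutions and its effect on length, rank and order. -/

section Involutions

variable {ι V N : Type*} [AddCommGroup V] [Module ℝ V] [AddCommGroup N] [Module ℝ N]
  {P : RootPairing ι ℝ V N}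

/-- The involution obtained from the involution `u` by the twisted action of the reflection `s`
with index `i`: this is `u * s` if `u` and `s` commute, and `s * u * s` otherwise. -/
def twist (u : P.weylGroup) (i : ι) : P.weylGroup :=
  open Classical in
  if u * weylGroup.ofIdx P i = weylGroup.ofIdx P i * u then u * weylGroup.ofIdx P i
  else weylGroup.ofIdx P i * (u * weylGroup.ofIdx P i)

theorem twist_of_commute {u : P.weylGroup} {i : ι}
    (h : u * weylGroup.ofIdx P i = weylGroup.ofIdx P i * u) :
    twist u i = u * weylGroup.ofIdx P i := if_pos h

theorem twist_of_not_commute {u : P.weylGroup} {i : ι}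
    (h : ¬ u * weylGroup.ofIdx P i = weylGroup.ofIdx P i * u) :
    twist u i = weylGroup.ofIdx P i * (u * weylGroup.ofIdx P i) := if_neg h

theorem twist_twist (u : P.weylGroup) (i : ι) : twist (twist u i) i = u := by
  by_cases h : u * weylGroup.ofIdx P i = weylGroup.ofIdx P i * u
  · rw [twist_of_commute h, twist_of_commute, mul_ofIdx_cancel]
    rw [mul_ofIdx_cancel, h, ofIdx_mul_cancel]
  · rw [twist_of_not_commute h, twist_of_not_commute]
    · rw [mul_assoc, mul_ofIdx_cancel, ofIdx_mul_cancel]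
    · rw [mul_assoc, mul_ofIdx_cancel, ofIdx_mul_cancel]
      exact fun h' => h h'.symm

theorem twist_mul_self {u : P.weylGroup} (hu : u * u = 1) (i : ι) :
    twist u i * twist u i = 1 := by
  by_cases h : u * weylGroup.ofIdx P i = weylGroup.ofIdx P i * u
  · rw [twist_of_commute h]
    nth_rw 2 [h]
    rw [← mul_assoc, mul_ofIdx_cancel, hu]
  · rw [twist_of_not_commute h]
    simp only [mul_assoc, ofIdx_mul_cancel]
    rw [← mul_assoc u u, hu, one_mul, ofIdx_mul_self]

theorem weylGroupRootRep_apply (u : P.weylGroup) (x : V) : P.weylGroupRootRep u x = u • x := rfl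

theorem rkOneSub_conj (u : P.weylGroup) (i : ι) :
    rkOneSub P (weylGroup.ofIdx P i * (u * weylGroup.ofIdx P i)) = rkOneSub P u := by
  have h : (1 - P.weylGroupRootRep (weylGroup.ofIdx P i * (u * weylGroup.ofIdx P i))) =
      (P.reflection i).toLinearMap ∘ₗ (1 - P.weylGroupRootRep u) ∘ₗ
        (P.reflection i).toLinearMap := by
    ext x
    simp [weylGroupRootRep_apply]
  rw [rkOneSub, rkOneSub, h, LinearMap.range_comp,
    LinearMap.range_comp_of_range_eq_top _ (LinearEquiv.range _)]
  exact LinearEquiv.finrank_map_eq (P.reflection i) _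

/-- With `v = us`, the range of `1 - u` is the direct sum of the range of `1 - v` and the line of
the root: the involution `v` is `-1` on the former and fixes the latter. -/
theorem rkOneSub_mul_ofIdx [P.IsRootSystem] (b : P.Base) {u : P.weylGroup} (hu : u * u = 1) {i : ι}
    (hc : u * weylGroup.ofIdx P i = weylGroup.ofIdx P i * u) (hi : u • P.root i = -P.root i) :
    rkOneSub P u = rkOneSub P (u * weylGroup.ofIdx P i) + 1 := by
  have : Module.Finite ℝ V := Module.Finite.of_basis b.toWeightBasis
  set v := u * weylGroup.ofIdx P i with hv
  have hsmul : ∀ x : V, u • x = v • x - P.coroot' i x • P.root i := by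
    intro x
    rw [hv, mul_smul, weylGroup.ofIdx_smul, Equiv.reflection_smul, reflection_apply, smul_sub,
      smul_comm u, hi, smul_neg]
    abel
  have hvi : v • P.root i = P.root i := by
    rw [hv, mul_smul, weylGroup.ofIdx_smul, Equiv.reflection_smul, reflection_apply_self,
      smul_neg, hi, neg_neg]
  have hvv : ∀ x : V, v • v • x = x := by
    intro x
    rw [← mul_smul, hv, ← twist_of_commute hc, twist_mul_self hu, one_smul]
  have hsup : LinearMap.range (1 - P.weylGroupRootRep u) =
      LinearMap.range (1 - P.weylGroupRootRep v) ⊔ Submodule.span ℝ {P.root i} := by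
    have hmem : P.root i ∈ LinearMap.range (1 - P.weylGroupRootRep u) := by
      refine ⟨(2⁻¹ : ℝ) • P.root i, ?_⟩
      rw [LinearMap.sub_apply, Module.End.one_apply, weylGroupRootRep_apply, smul_comm u, hi]
      module
    apply le_antisymm
    · rintro _ ⟨x, rfl⟩
      refine Submodule.mem_sup.2 ⟨_, ⟨x, rfl⟩, P.coroot' i x • P.root i,
        Submodule.smul_mem _ _ (Submodule.mem_span_singleton_self _), ?_⟩
      simp only [LinearMap.sub_apply, Module.End.one_apply, weylGroupRootRep_apply, hsmul x]
      abel
    · refine sup_le ?_ ((Submodule.span_singleton_le_iff_mem _ _).2 hmem)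
      rintro _ ⟨x, rfl⟩
      have : (1 - P.weylGroupRootRep v) x =
          (1 - P.weylGroupRootRep u) x - P.coroot' i x • P.root i := by
        simp only [LinearMap.sub_apply, Module.End.one_apply, weylGroupRootRep_apply, hsmul x]
        abel
      rw [this]
      exact Submodule.sub_mem _ ⟨x, rfl⟩ (Submodule.smul_mem _ _ hmem)
  have hinf : LinearMap.range (1 - P.weylGroupRootRep v) ⊓ Submodule.span ℝ {P.root i} = ⊥ := by
    rw [eq_bot_iff]
    rintro y ⟨⟨x, hx⟩, hy⟩
    obtain ⟨c, rfl⟩ := Submodule.mem_span_singleton.1 hy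
    rw [LinearMap.sub_apply, Module.End.one_apply, weylGroupRootRep_apply] at hx
    have h₁ : v • (c • P.root i) = c • P.root i := by rw [smul_comm v, hvi]
    have h₂ : v • (c • P.root i) = -(c • P.root i) := by
      rw [← hx, smul_sub, hvv, neg_sub]
    have h₃ : (2 : ℝ) • c • P.root i = 0 := by
      rw [two_smul]
      nth_rw 1 [← h₁, h₂]
      exact neg_add_cancel _
    exact (smul_eq_zero.1 h₃).resolve_left two_ne_zero
  have hfin := Submodule.finrank_sup_add_finrank_inf_eq
    (LinearMap.range (1 - P.weylGroupRootRep v)) (Submodule.span ℝ {P.root i})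
  rw [hinf, finrank_bot, add_zero, finrank_span_singleton (P.ne_zero i), ← hsup] at hfin
  exact hfin

variable [P.IsReduced] {b : P.Base}

/-- Commuting makes the reflections in the root and in its image under `u` equal, so the two are
proportional, hence equal up to sign by reducedness. -/
theorem smul_root_eq_neg_of_commute {u : P.weylGroup} {i : ι} (hi : i ∈ b.support)
    (hneg : ¬ b.IsPos (P.weylGroupToPerm u i))
    (h : u * weylGroup.ofIdx P i = weylGroup.ofIdx P i * u) :
    u • P.root i = -P.root i := by
  rw [P.weylGroup_apply_root]
  set k := P.weylGroupToPerm u i with hk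
  have hki : weylGroup.ofIdx P k = weylGroup.ofIdx P i :=
    mul_right_cancel ((mul_ofIdx u i).symm.trans h)
  have hne : k ≠ i := fun h' => hneg (h' ▸ isPos_of_mem b hi)
  have hroot : P.reflection i (P.root k) = -P.root k := by
    have := congrArg (fun g : P.weylGroup => g • P.root k) hki
    simpa using this.symm
  rw [reflection_apply] at hroot
  refine IsReduced.eq_or_eq_neg k i ?_ |>.resolve_left (fun h' => hne (P.root.injective h'))
  rw [LinearIndependent.pair_iff]
  intro hlin
  have := (hlin 2 (-P.coroot' i (P.root k)) (by
    rw [sub_eq_iff_eq_add] at hroot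
    rw [two_smul, neg_smul]
    nth_rw 1 [hroot]
    abel)).1
  norm_num at this

variable [Finite ι] [P.IsCrystallographic]

/-- The image of the simple root under `u` is negative and, without commutation, not minus that
root, so `s` keeps it negative. Thus `s` is a left descent of `us`. -/
theorem not_isPos_mul_ofIdx_inv {u : P.weylGroup} (hu : u * u = 1) {i : ι} (hi : i ∈ b.support)
    (hneg : ¬ b.IsPos (P.weylGroupToPerm u i))
    (h : ¬ u * weylGroup.ofIdx P i = weylGroup.ofIdx P i * u) :
    ¬ b.IsPos (P.weylGroupToPerm (u * weylGroup.ofIdx P i)⁻¹ i) := by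
  rw [mul_inv_rev, inv_eq_of_mul_eq_one_left hu, ofIdx_inv, map_mul, Equiv.Perm.mul_apply]
  set k := P.weylGroupToPerm u i with hk
  have hne : P.reflectionPerm k k ≠ i := by
    intro h'
    apply h
    rw [mul_ofIdx, ← hk, ← ofIdx_reflectionPerm_self k, h']
  have hpos := ((isPos_reflectionPerm_self b k).2 hneg).reflectionPerm hi hne
  rwa [← weylGroupToPerm_ofIdx i, weylGroupToPerm_reflectionPerm_self,
    isPos_reflectionPerm_self] at hpos

theorem length_twist_lt {u : P.weylGroup} (hu : u * u = 1) {i : ι}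
    (hi : i ∈ b.support) (hneg : ¬ b.IsPos (P.weylGroupToPerm u i)) :
    length b (twist u i) < length b u := by
  have hl := length_eq_mul_simple_add_one b u hi hneg
  by_cases h : u * weylGroup.ofIdx P i = weylGroup.ofIdx P i * u
  · rw [twist_of_commute h]
    lia
  · have hl' := length_eq_mul_simple_add_one b _ hi (not_isPos_mul_ofIdx_inv hu hi hneg h)
    rw [← length_inv b (_ * _), inv_inv_mul_ofIdx, length_inv] at hl'
    rw [twist_of_not_commute h]
    lia

theorem BruhatLE.le_twist {w σ : P.weylGroup} (hw : w * w = 1) (hσ : σ * σ = 1)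
    (hle : BruhatLE b w σ) {i : ι} (hi : i ∈ b.support) (hwi : b.IsPos (P.weylGroupToPerm w i))
    (hσi : ¬ b.IsPos (P.weylGroupToPerm σ i)) : BruhatLE b w (twist σ i) := by
  have h₁ := hle.le_mul hi hwi hσi
  by_cases h : σ * weylGroup.ofIdx P i = weylGroup.ofIdx P i * σ
  · rwa [twist_of_commute h]
  · rw [twist_of_not_commute h]
    exact h₁.left_le_mul hi (by rwa [inv_eq_of_mul_eq_one_left hw])
      (not_isPos_mul_ofIdx_inv hσ hi hσi h)

theorem BruhatLE.twist_le_twist {w σ : P.weylGroup} (hw : w * w = 1) (hσ : σ * σ = 1)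
    (hle : BruhatLE b w σ) {i : ι} (hi : i ∈ b.support)
    (hwi : ¬ b.IsPos (P.weylGroupToPerm w i)) (hσi : ¬ b.IsPos (P.weylGroupToPerm σ i)) :
    BruhatLE b (twist w i) (twist σ i) := by
  have h₁ := hle.mul_mul hi hwi hσi
  by_cases h : σ * weylGroup.ofIdx P i = weylGroup.ofIdx P i * σ <;>
    by_cases h' : w * weylGroup.ofIdx P i = weylGroup.ofIdx P i * w
  · rwa [twist_of_commute h, twist_of_commute h']
  -- Here `sws ≤ ws ≤ σs`.
  · rw [twist_of_commute h, twist_of_not_commute h']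
    exact (left_mul_le_of_descent hi (not_isPos_mul_ofIdx_inv hw hi hwi h')).trans h₁
  -- Here `s` is a left descent of `σs` but not of `ws = sw`, so it can be removed from `σs` alone.
  · rw [twist_of_not_commute h, twist_of_commute h']
    refine h₁.left_le_mul hi ?_ (not_isPos_mul_ofIdx_inv hσ hi hσi h)
    rwa [h', mul_inv_rev, ofIdx_inv, inv_eq_of_mul_eq_one_left hw, isPos_mul_ofIdx_iff]
  · rw [twist_of_not_commute h, twist_of_not_commute h']
    exact h₁.left_mul_mul hi (not_isPos_mul_ofIdx_inv hw hi hwi h')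
      (not_isPos_mul_ofIdx_inv hσ hi hσi h)

variable [P.IsRootSystem]

theorem length_add_rkOneSub_twist {u : P.weylGroup} (hu : u * u = 1) {i : ι}
    (hi : i ∈ b.support) (hneg : ¬ b.IsPos (P.weylGroupToPerm u i)) :
    length b u + rkOneSub P u = length b (twist u i) + rkOneSub P (twist u i) + 2 := by
  have hl := length_eq_mul_simple_add_one b u hi hneg
  by_cases h : u * weylGroup.ofIdx P i = weylGroup.ofIdx P i * u
  · have hr := rkOneSub_mul_ofIdx b hu h (smul_root_eq_neg_of_commute hi hneg h)
    rw [twist_of_commute h]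
    lia
  · have hl' := length_eq_mul_simple_add_one b _ hi (not_isPos_mul_ofIdx_inv hu hi hneg h)
    rw [← length_inv b (_ * _), inv_inv_mul_ofIdx, length_inv] at hl'
    rw [twist_of_not_commute h, rkOneSub_conj]
    lia

/-- On involutions `length + rkOneSub` is strictly monotone for the Bruhat order. -/
theorem BruhatLE.length_add_rkOneSub {w σ : P.weylGroup} (hw : w * w = 1) (hσ : σ * σ = 1)
    (hle : BruhatLE b w σ) :
    w = σ ∨ length b w + rkOneSub P w < length b σ + rkOneSub P σ := by
  induction hn : length b σ using Nat.strong_induction_on generalizing w σ with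
  | _ n ih =>
    subst hn
    by_cases h1 : σ = 1
    -- No step ends at the identity, whose length is 0.
    · rcases Relation.ReflTransGen.cases_tail hle with h | ⟨u, -, hu⟩
      · exact Or.inl h.symm
      · obtain ⟨i, -, hlt⟩ := hu
        have := length_wordProd_le b []
        rw [h1, show (1 : P.weylGroup) = wordProd b [] by simp [wordProd]] at hlt
        simp at this
        lia
    · obtain ⟨i, hi, hσi⟩ := exists_descent b h1
      have hlt := length_twist_lt hσ hi hσi
      have hf := length_add_rkOneSub_twist hσ hi hσi
      by_cases hwi : b.IsPos (P.weylGroupToPerm w i)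
      · right
        rcases ih _ hlt hw (twist_mul_self hσ i) (hle.le_twist hw hσ hi hwi hσi) rfl with h | h
        · rw [h]
          lia
        · lia
      · have hf' := length_add_rkOneSub_twist hw hi hwi
        rcases ih _ hlt (twist_mul_self hw i) (twist_mul_self hσ i)
          (hle.twist_le_twist hw hσ hi hwi hσi) rfl with h | h
        · left
          rw [← twist_twist w i, h, twist_twist]
        · right
          lia

end Involutions

end WeylInvolutions

end

theorem lemma5p2 {ι V N : Type*} [Finite ι]
    [AddCommGroup V] [Module ℝ V] [AddCommGroup N] [Module ℝ N]
    (P : RootPairing ι ℝ V N) [P.IsRootSystem] [P.IsCrystallographic] [P.IsReduced]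
    (b : P.Base) (w σ : P.weylGroup)
    (hw : w * w = 1) (hσ : σ * σ = 1)
    (hle : WeylInvolutions.BruhatLE b w σ)
    (hrk : WeylInvolutions.length b w + WeylInvolutions.rkOneSub P w =
      WeylInvolutions.length b σ + WeylInvolutions.rkOneSub P σ) :
    w = σ := by
  rcases hle.length_add_rkOneSub hw hσ with h | h
  · exact h
  · exact absurd hrk h.ne
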